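/- Let $N\ge 0$ and $d\ge 0$ be integers and let $[x_k]=(x_0,\dots,x_N)$ be a zero-mean nonsingular Gaussian (ZMNG) sequence of random vectors in $\mathbb{R}^d$ on a probability space; that is, $x_0,\dots,x_N$ are jointly Gaussian with mean zero and the covariance matrix of the stacked vector $(x_0',\dots,x_N')'$ is nonsingular. Call a sequence Markov if, for every time $k$, the segment before $k$ and the segment after $k$ are conditionally independent given the state at time $k$. Call $[x_k]$ reciprocal if, for all times $j<l$, the family $(x_i)_{j<i<l}$ and the family $(x_i)_{i<j\text{ or }i>l}$ are conditionally independent given $(x_j,x_l)$. Then $[x_k]$ is reciprocal if and only if it can be represented (almost surely) both as $$x_k=y^L_k+\Gamma^L_k x_N,\qquad k\in\{0,\dots,N-1\},$$ and as $$x_k=y^F_k+\Gamma^F_k x_0,\qquad k\in\{1,\dots,N\},$$ where $(y^L_k)_{k=0}^{N-1}$ and $(y^F_k)_{k=1}^{N}$ are ZMNG Markov sequences of random vectors in $\mathbb{R}^d$, $x_N$ is a ZMNG vector uncorrelated with $(y^L_k)_{k=0}^{N-1}$, $x_0$ is a ZMNG vector uncorrelated with $(y^F_k)_{k=1}^{N}$,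 and $\Gamma^L_k$, $\Gamma^F_k$ are some real $d\times d$ matrices. -/

import Mathlib

open MeasureTheory ProbabilityTheory

namespace GaussSeq

/-- The σ-algebra on `Ω` generated by the random vectors `x i`, `i ∈ S`. -/
abbrev sigmaOf {Ω ι E : Type*} [MeasurableSpace E] (x : ι → Ω → E) (S : Set ι) :
    MeasurableSpace Ω :=
  ⨆ i ∈ S, MeasurableSpace.comap (x i) inferInstance

/-- Conditional independence of the σ-algebras `m₁` and `m₂` given the σ-algebra `m'`:
`P(A ∩ B | m') = P(A | m') P(B | m')` almost surely for `A ∈ m₁`, `B ∈ m₂`.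
(Mathlib's `CondIndep` is the same condition, but is only available on standard Borel spaces.)
It is used below only for sub-σ-algebras of that of `Ω`. -/
def CondIndepGiven {Ω : Type*} (m' m₁ m₂ : MeasurableSpace Ω) {mΩ : MeasurableSpace Ω}
    (μ : Measure Ω) : Prop :=
  ∀ A B : Set Ω, MeasurableSet[m₁] A → MeasurableSet[m₂] B →
    μ⟦A ∩ B | m'⟧ =ᵐ[μ] μ⟦A | m'⟧ * μ⟦B | m'⟧

/-- Markov sequence over a linearly ordered index set: for every time `k`, the segment before `k`
and the segment after `k` are conditionally independent given the state at time `k`. -/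
def IsMarkov {Ω ι E : Type*} [LinearOrder ι] [MeasurableSpace E] [MeasurableSpace Ω]
    (x : ι → Ω → E) (μ : Measure Ω) : Prop :=
  ∀ k : ι, CondIndepGiven (sigmaOf x {k}) (sigmaOf x (Set.Iio k)) (sigmaOf x (Set.Ioi k)) μ

/-- Reciprocal sequence over a linearly ordered index set: for all times `j < l`, the segment
inside `(j, l)` and the two segments outside `[j, l]` (jointly) are conditionally independent
given the states at times `j` and `l`. -/
def IsReciprocal {Ω ι E : Type*} [LinearOrder ι] [MeasurableSpace E] [MeasurableSpace Ω]
    (x : ι → Ω → E) (μ : Measure Ω) : Prop :=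
  ∀ j l : ι, j < l →
    CondIndepGiven (sigmaOf x {j, l}) (sigmaOf x (Set.Ioo j l)) (sigmaOf x (Set.Icc j l)ᶜ) μ

/-- Covariance matrix of a finite-dimensional random vector. -/
noncomputable def covMat {Ω κ : Type*} [MeasurableSpace Ω] (X : Ω → κ → ℝ) (μ : Measure Ω) :
    Matrix κ κ ℝ :=
  Matrix.of fun a b => cov[fun ω => X ω a, fun ω => X ω b; μ]

/-- Zero-mean nonsingular Gaussian random vector. -/
structure IsZMNG {Ω κ : Type*} [Fintype κ] [DecidableEq κ] [MeasurableSpace Ω]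
    (X : Ω → κ → ℝ) (μ : Measure Ω) : Prop where
  measurable : Measurable X
  gaussian : HasGaussianLaw X μ
  zero_mean : ∀ a, ∫ ω, X ω a ∂μ = 0
  nonsingular : (covMat X μ).det ≠ 0

/-- Zero-mean nonsingular Gaussian sequence of `d`-dimensional vectors: the states are jointly
Gaussian with mean zero, and the covariance matrix of the whole sequence is nonsingular. -/
def IsZMNGSeq {Ω ι : Type*} [Fintype ι] [DecidableEq ι] {d : ℕ} [MeasurableSpace Ω]
    (x : ι → Ω → Fin d → ℝ) (μ : Measure Ω) : Prop :=
  IsZMNG (fun ω (p : ι × Fin d) => x p.1 ω p.2) μ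

/-- The sequence `x` is represented as `x_k = y_k + Γ_k x_c` for all times `k ≠ c`, where
`(y_k)_{k ≠ c}` is a zero-mean nonsingular Gaussian Markov sequence and `x_c` is a zero-mean
nonsingular Gaussian vector that is uncorrelated with `(y_k)_{k ≠ c}`. -/
structure IsMarkovRep {Ω : Type*} {N d : ℕ} [MeasurableSpace Ω]
    (x : Fin (N + 1) → Ω → Fin d → ℝ) (μ : Measure Ω) (c : Fin (N + 1))
    (y : {k : Fin (N + 1) // k ≠ c} → Ω → Fin d → ℝ)
    (Γ : {k : Fin (N + 1) // k ≠ c} → Matrix (Fin d) (Fin d) ℝ) : Prop where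
  seq_zmng : IsZMNGSeq y μ
  seq_markov : IsMarkov y μ
  vec_zmng : IsZMNG (x c) μ
  uncorrelated : ∀ k a b, cov[fun ω => y k ω a, fun ω => x c ω b; μ] = 0
  eq_sum : ∀ k : {k : Fin (N + 1) // k ≠ c}, ∀ᵐ ω ∂μ, x k ω = y k ω + (Γ k).mulVec (x c ω)

end GaussSeq

/-! Every condition is a zero pattern of the precision matrix `P`, the inverse of the covariance of
the stacked vector. Two blocks of a nonsingular Gaussian vector are conditionally independent given
the rest iff their block of `P` vanishes (`condIndepGiven_iff_precision`). So Markov means `P` is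
block tridiagonal, and reciprocal means the same except that the corner blocks coupling times `0`
and `N` are free.

In any representation `x_k = y_k + Γ_k x_c` with `y` uncorrelated with `x_c`, the precision of `y`
is `P` with time `c` deleted (`covMat_mul_toBlocks₁₁`, a Schur complement), and the regression
residual realizes it. Hence a Markov representation at `c` exists iff this deleted matrix is block
tridiagonal (`exists_isMarkovRep_iff`). Deleting `N` and deleting `0` together control every block
except the free corners. -/

namespace GaussSeq

open Matrix

/-! ### Conditional independence after removing an independent conditioning variable. -/

section CondIndep

variable {Ω 𝓤 𝓥 𝓩 : Type*} [MeasurableSpace Ω] {μ : Measure Ω} [IsProbabilityMeasure μ]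
  [MeasurableSpace 𝓤] [MeasurableSpace 𝓥] [MeasurableSpace 𝓩]

/-- If `W` is independent of `Z`, then conditioning an event about `(Z, W)` on `Z` amounts to
freezing the value of `Z`. -/
theorem condExp_prodMk_mem_of_indepFun [StandardBorelSpace 𝓤] [Nonempty 𝓤]
    {W : Ω → 𝓤} {Z : Ω → 𝓩} (hW : Measurable W) (hZ : Measurable Z) (h : IndepFun Z W μ)
    {D : Set (𝓩 × 𝓤)} (hD : MeasurableSet D) :
    μ⟦(fun ω => (Z ω, W ω)) ⁻¹' D | MeasurableSpace.comap Z inferInstance⟧ =ᵐ[μ]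
      fun ω => (μ.map W).real (Prod.mk (Z ω) ⁻¹' D) := by
  -- By independence the joint law is a product, so the conditional law of `W` is a constant kernel.
  have hc : condDistrib W Z μ =ᵐ[μ.map Z] Kernel.const 𝓩 (μ.map W) := by
    apply condDistrib_ae_eq_of_measure_eq_compProd Z hW.aemeasurable
    rw [Measure.compProd_const]
    exact (indepFun_iff_map_prod_eq_prod_map_map hZ.aemeasurable hW.aemeasurable).1 h
  have hf : StronglyMeasurable (D.indicator (fun _ => (1 : ℝ))) :=
    stronglyMeasurable_const.indicator hD
  have h1 := condExp_prod_ae_eq_integral_condDistrib (μ := μ) hZ hW.aemeasurable hf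
    ((integrable_const (1 : ℝ)).indicator ((hZ.prodMk hW) hD))
  have h2 := ae_of_ae_map hZ.aemeasurable hc
  filter_upwards [h1, h2] with ω h1 h2
  refine Eq.trans h1 ?_
  rw [h2, Kernel.const_apply]
  exact integral_indicator_one (μ := μ.map W) (measurable_prodMk_left hD)

/-- If `(U, V)` is independent of `Z`, then `U + g(Z)` and `V + h(Z)` are conditionally independent
given `Z` if and only if `U` and `V` are independent. -/
theorem condIndepGiven_add_iff_indepFun
    [StandardBorelSpace 𝓤] [StandardBorelSpace 𝓥] [AddGroup 𝓤] [AddGroup 𝓥]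
    [MeasurableAdd₂ 𝓤] [MeasurableAdd₂ 𝓥] [MeasurableSub₂ 𝓤] [MeasurableSub₂ 𝓥]
    {U : Ω → 𝓤} {V : Ω → 𝓥} {Z : Ω → 𝓩} {g : 𝓩 → 𝓤} {h : 𝓩 → 𝓥}
    (hU : Measurable U) (hV : Measurable V) (hZ : Measurable Z)
    (hg : Measurable g) (hh : Measurable h)
    (hind : IndepFun Z (fun ω => (U ω, V ω)) μ) :
    CondIndepGiven (MeasurableSpace.comap Z inferInstance)
      (MeasurableSpace.comap (fun ω => U ω + g (Z ω)) inferInstance)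
      (MeasurableSpace.comap (fun ω => V ω + h (Z ω)) inferInstance) μ ↔ IndepFun U V μ := by
  have hUV : Measurable fun ω => (U ω, V ω) := hU.prodMk hV
  have : IsProbabilityMeasure (μ.map U) := Measure.isProbabilityMeasure_map hU.aemeasurable
  have : IsProbabilityMeasure (μ.map V) := Measure.isProbabilityMeasure_map hV.aemeasurable
  have : IsProbabilityMeasure (μ.map Z) := Measure.isProbabilityMeasure_map hZ.aemeasurable
  have : IsProbabilityMeasure (μ.map fun ω => (U ω, V ω)) :=
    Measure.isProbabilityMeasure_map hUV.aemeasurable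
  have hmeasA {E : Set 𝓤} (hE : MeasurableSet E) : MeasurableSet {p : 𝓩 × 𝓤 | p.2 + g p.1 ∈ E} :=
    (measurable_snd.add (hg.comp measurable_fst)) hE
  have hmeasB {F : Set 𝓥} (hF : MeasurableSet F) : MeasurableSet {p : 𝓩 × 𝓥 | p.2 + h p.1 ∈ F} :=
    (measurable_snd.add (hh.comp measurable_fst)) hF
  have hA {E : Set 𝓤} (hE : MeasurableSet E) :
      μ⟦(fun ω => U ω + g (Z ω)) ⁻¹' E | MeasurableSpace.comap Z inferInstance⟧ =ᵐ[μ]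
        fun ω => (μ.map U).real {u | u + g (Z ω) ∈ E} :=
    condExp_prodMk_mem_of_indepFun hU hZ (hind.comp measurable_id measurable_fst) (hmeasA hE)
  have hB {F : Set 𝓥} (hF : MeasurableSet F) :
      μ⟦(fun ω => V ω + h (Z ω)) ⁻¹' F | MeasurableSpace.comap Z inferInstance⟧ =ᵐ[μ]
        fun ω => (μ.map V).real {v | v + h (Z ω) ∈ F} :=
    condExp_prodMk_mem_of_indepFun hV hZ (hind.comp measurable_id measurable_snd) (hmeasB hF)
  have hAB {E : Set 𝓤} {F : Set 𝓥} (hE : MeasurableSet E) (hF : MeasurableSet F) :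
      μ⟦(fun ω => U ω + g (Z ω)) ⁻¹' E ∩ (fun ω => V ω + h (Z ω)) ⁻¹' F |
          MeasurableSpace.comap Z inferInstance⟧ =ᵐ[μ]
        fun ω => (μ.map fun ω => (U ω, V ω)).real
          ({u | u + g (Z ω) ∈ E} ×ˢ {v | v + h (Z ω) ∈ F}) :=
    condExp_prodMk_mem_of_indepFun hUV hZ hind
      (D := {p | p.2.1 + g p.1 ∈ E} ∩ {p | p.2.2 + h p.1 ∈ F})
      (((measurable_snd.fst.add (hg.comp measurable_fst)) hE).inter
        ((measurable_snd.snd.add (hh.comp measurable_fst)) hF))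
  rw [indepFun_iff_map_prod_eq_prod_map_map hU.aemeasurable hV.aemeasurable]
  constructor
  · intro hci
    -- The shear `T` turns `(Z, U, V)` into `(Z, U + g(Z), V + h(Z))`; `T'` undoes it and forgets
    -- `z`. Equality of the sheared laws therefore gives equality of the laws on `𝓤 × 𝓥`.
    let T : 𝓩 × 𝓤 × 𝓥 → 𝓩 × 𝓤 × 𝓥 := fun p => (p.1, p.2.1 + g p.1, p.2.2 + h p.1)
    let T' : 𝓩 × 𝓤 × 𝓥 → 𝓤 × 𝓥 := fun p => (p.2.1 - g p.1, p.2.2 - h p.1)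
    have hT : Measurable T := by fun_prop
    have hT' : Measurable T' := by fun_prop
    have hTT' : T' ∘ T = Prod.snd := by ext p <;> simp [T, T']
    have key : ((μ.map Z).prod (μ.map fun ω => (U ω, V ω))).map T =
        ((μ.map Z).prod ((μ.map U).prod (μ.map V))).map T := by
      have : IsProbabilityMeasure
        (((μ.map Z).prod (μ.map fun ω => (U ω, V ω))).map T) :=
        Measure.isProbabilityMeasure_map hT.aemeasurable
      -- The null set in the conditional identities depends on `E` and `F`, so the boxes are fixed
      -- first and the laws compared on them.
      refine Measure.ext_prod₃ fun {C E F} hC hE hF => ?_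
      have hm : MeasurableSet (C ×ˢ E ×ˢ F) := hC.prod (hE.prod hF)
      rw [Measure.map_apply hT hm, Measure.map_apply hT hm,
        Measure.prod_apply (hT hm), Measure.prod_apply (hT hm)]
      have hae : ∀ᵐ ω ∂μ, (μ.map fun ω => (U ω, V ω)).real
          ({u | u + g (Z ω) ∈ E} ×ˢ {v | v + h (Z ω) ∈ F}) =
          ((μ.map U).prod (μ.map V)).real
          ({u | u + g (Z ω) ∈ E} ×ˢ {v | v + h (Z ω) ∈ F}) := by
        filter_upwards [hA hE, hB hF, hAB hE hF, hci _ _ ⟨E, hE, rfl⟩ ⟨F, hF, rfl⟩]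
          with ω h1 h2 h3 h4
        rw [measureReal_prod_prod, ← h1, ← h2, ← h3, h4]
        rfl
      rw [lintegral_map (measurable_measure_prodMk_left (hT hm)) hZ,
        lintegral_map (measurable_measure_prodMk_left (hT hm)) hZ]
      refine lintegral_congr_ae ?_
      filter_upwards [hae] with ω hω
      by_cases hz : Z ω ∈ C
      · have : Prod.mk (Z ω) ⁻¹' (T ⁻¹' C ×ˢ E ×ˢ F) =
            {u | u + g (Z ω) ∈ E} ×ˢ {v | v + h (Z ω) ∈ F} := by
          ext p; simp [T, hz]
        rw [this]
        exact (measureReal_eq_measureReal_iff).1 hω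
      · have : Prod.mk (Z ω) ⁻¹' (T ⁻¹' C ×ˢ E ×ˢ F) = ∅ := by
          ext p; simp [T, hz]
        simp [this]
    have key2 := congrArg (Measure.map T') key
    rw [Measure.map_map hT' hT, Measure.map_map hT' hT, hTT'] at key2
    simpa using key2
  · rintro hp _ _ ⟨E, hE, rfl⟩ ⟨F, hF, rfl⟩
    filter_upwards [hA hE, hB hF, hAB hE hF] with ω h1 h2 h3
    rw [Pi.mul_apply, h1, h2, h3, hp, measureReal_prod_prod]

end CondIndep

/-! ### Block inverses. -/

section Matrices

variable {α β : Type*} [Fintype α] [Fintype β] [DecidableEq α] [DecidableEq β]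

/-- Inverse of a Schur complement: if `C P = 1` and `C₁₁ = D + Γ C₂₁`, `C₁₂ = Γ C₂₂`, then `D` is
inverse to the block `P₁₁`. -/
theorem schur_mul_toBlocks₁₁ {C P : Matrix (α ⊕ β) (α ⊕ β) ℝ} {D : Matrix α α ℝ}
    {Γ : Matrix α β ℝ} (hCP : C * P = 1) (h₁₁ : C.toBlocks₁₁ = D + Γ * C.toBlocks₂₁)
    (h₁₂ : C.toBlocks₁₂ = Γ * C.toBlocks₂₂) : D * P.toBlocks₁₁ = 1 := by
  rw [← fromBlocks_toBlocks C, ← fromBlocks_toBlocks P, fromBlocks_multiply, ← fromBlocks_one,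
    fromBlocks_inj] at hCP
  obtain ⟨e₁, -, e₂, -⟩ := hCP
  rw [h₁₁, h₁₂, Matrix.add_mul, Matrix.mul_assoc, Matrix.mul_assoc, add_assoc, ← Matrix.mul_add,
    e₂, Matrix.mul_zero, add_zero] at e₁
  exact e₁

/-- The off-diagonal block of `D * Q = 1` reads `D₁₁ Q₁₂ + D₁₂ Q₂₂ = 0`, where `D₁₁` and `Q₂₂` are
invertible as principal blocks of positive definite matrices. -/
theorem toBlocks₁₂_eq_zero_iff_of_mul_eq_one {D Q : Matrix (α ⊕ β) (α ⊕ β) ℝ} (hD : D.PosDef)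
    (hQ : Q.PosDef) (h : D * Q = 1) : D.toBlocks₁₂ = 0 ↔ Q.toBlocks₁₂ = 0 := by
  have h₁ : IsUnit D.toBlocks₁₁ := (hD.submatrix Sum.inl_injective).isUnit
  have h₂ : IsUnit Q.toBlocks₂₂ := (hQ.submatrix Sum.inr_injective).isUnit
  rw [← fromBlocks_toBlocks D, ← fromBlocks_toBlocks Q, fromBlocks_multiply, ← fromBlocks_one,
    fromBlocks_inj] at h
  have e := h.2.1
  rw [isUnit_iff_isUnit_det] at h₁ h₂
  constructor
  · intro h0
    rw [h0, Matrix.zero_mul, add_zero] at e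
    rw [← Matrix.one_mul Q.toBlocks₁₂, ← nonsing_inv_mul _ h₁, Matrix.mul_assoc, e, Matrix.mul_zero]
  · intro h0
    rw [h0, Matrix.mul_zero, zero_add] at e
    rw [← Matrix.mul_one D.toBlocks₁₂, ← mul_nonsing_inv _ h₂, ← Matrix.mul_assoc, e,
      Matrix.zero_mul]

end Matrices

/-! ### Gaussian vectors, regression and the precision matrix. -/

section Gaussian

variable {Ω κ κ' ρ σ : Type*} [MeasurableSpace Ω] {μ : Measure Ω} [IsProbabilityMeasure μ]
  [Fintype κ] [DecidableEq κ] [Fintype κ'] [DecidableEq κ'] [Fintype ρ] [DecidableEq ρ]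
  [Fintype σ] [DecidableEq σ]

omit [IsProbabilityMeasure μ] in
theorem covariance_congr_left_ae {X X' Y : Ω → ℝ} (h : X =ᵐ[μ] X') :
    cov[X, Y; μ] = cov[X', Y; μ] := by
  rw [covariance, covariance, integral_congr_ae h]
  refine integral_congr_ae ?_
  filter_upwards [h] with ω hω
  rw [hω]

omit [IsProbabilityMeasure μ] in
theorem IsZMNG.memLp_two {X : Ω → κ → ℝ} (hX : IsZMNG X μ) (k : κ) :
    MemLp (fun ω => X ω k) 2 μ :=
  (hX.gaussian.eval k).memLp_two

/-- The quadratic form of the covariance is the variance of a linear combination, hence nonnegative;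
nonsingularity makes it definite. -/
theorem IsZMNG.posDef {X : Ω → κ → ℝ} (hX : IsZMNG X μ) : (covMat X μ).PosDef := by
  have hps : (covMat X μ).PosSemidef := by
    refine .of_dotProduct_mulVec_nonneg ?_ fun v => ?_
    · ext a b
      exact covariance_comm _ _
    · have h : star v ⬝ᵥ covMat X μ *ᵥ v = Var[fun ω => ∑ k, v k * X ω k; μ] := by
        rw [← covariance_self, covariance_fun_sum_fun_sum
          (fun k => (hX.memLp_two k).const_mul (v k)) (fun k => (hX.memLp_two k).const_mul (v k))]
        · simp only [dotProduct, mulVec, Finset.mul_sum, covariance_const_mul_left,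
            covariance_const_mul_right, covMat, Matrix.of_apply, star_trivial]
          exact Finset.sum_congr rfl fun _ _ => Finset.sum_congr rfl fun _ _ => by ring
        · exact (memLp_finsetSum _ fun k _ => (hX.memLp_two k).const_mul (v k)).aemeasurable
      rw [h]
      exact variance_nonneg _ _
  exact hps.posDef_iff_det_ne_zero.2 hX.nonsingular

omit [IsProbabilityMeasure μ] in
theorem IsZMNG.covMat_mul_inv {X : Ω → κ → ℝ} (hX : IsZMNG X μ) :
    covMat X μ * (covMat X μ)⁻¹ = 1 :=
  mul_nonsing_inv _ hX.nonsingular.isUnit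

theorem IsZMNG.comp_injective {X : Ω → κ → ℝ} (hX : IsZMNG X μ) {f : κ' → κ}
    (hf : f.Injective) : IsZMNG (fun ω k => X ω (f k)) μ where
  measurable := measurable_pi_lambda _ fun _ => (measurable_pi_apply _).comp hX.measurable
  gaussian := hX.gaussian.map
    (ContinuousLinearMap.pi fun k => ContinuousLinearMap.proj (R := ℝ) (φ := fun _ => ℝ) (f k))
  zero_mean k := hX.zero_mean (f k)
  nonsingular := (hX.posDef.submatrix hf).det_pos.ne'

/-- If `X_ρ = W + Γ X_σ` with `W` uncorrelated with `X_σ`, then the covariance matrix of `W` is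
inverse to the corresponding block of the precision matrix of `X`. -/
theorem covMat_mul_toBlocks₁₁ {X : Ω → ρ ⊕ σ → ℝ} (hX : IsZMNG X μ) {W : Ω → ρ → ℝ}
    (hW : ∀ r, MemLp (fun ω => W ω r) 2 μ) {Γ : Matrix ρ σ ℝ}
    (hcov : ∀ r s, cov[fun ω => W ω r, fun ω => X ω (.inr s); μ] = 0)
    (heq : ∀ r, ∀ᵐ ω ∂μ, X ω (.inl r) = W ω r + ∑ s, Γ r s * X ω (.inr s)) :
    covMat W μ * (covMat X μ)⁻¹.toBlocks₁₁ = 1 := by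
  have hs (r s) : MemLp (fun ω => Γ r s * X ω (.inr s)) 2 μ := (hX.memLp_two _).const_mul _
  have hS (r) : MemLp (fun ω => ∑ s, Γ r s * X ω (.inr s)) 2 μ := memLp_finsetSum _ fun s _ => hs r s
  have expand (r) {Y : Ω → ℝ} (hY : MemLp Y 2 μ) : cov[fun ω => X ω (.inl r), Y; μ] =
      cov[fun ω => W ω r, Y; μ] + ∑ s, Γ r s * cov[fun ω => X ω (.inr s), Y; μ] := by
    rw [covariance_congr_left_ae (heq r)]
    refine (covariance_add_left (hW r) (hS r) hY).trans ?_
    rw [covariance_fun_sum_left (hs r) hY]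
    simp only [covariance_const_mul_left]
  refine schur_mul_toBlocks₁₁ (Γ := Γ) hX.covMat_mul_inv ?_ ?_
  · ext r r'
    refine (expand r (hX.memLp_two _)).trans (congrArg₂ _ ?_ rfl)
    -- Expanding the other argument too leaves `cov[W r, W r']`, as `W` is uncorrelated with `X_σ`.
    rw [covariance_comm, expand r' (hW r), covariance_comm]
    simp [covariance_comm (fun ω => X ω (.inr _)), hcov, covMat]
  · ext r s
    refine (expand r (hX.memLp_two _)).trans ?_
    rw [hcov, zero_add]
    rfl

/-- Matrix of the regression of `X_ρ` on `X_σ`. -/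
noncomputable def regression (X : Ω → ρ ⊕ σ → ℝ) (μ : Measure Ω) : Matrix ρ σ ℝ :=
  (covMat X μ).toBlocks₁₂ * (covMat X μ).toBlocks₂₂⁻¹

/-- Residual of the regression of `X_ρ` on `X_σ`. -/
noncomputable def residual (X : Ω → ρ ⊕ σ → ℝ) (μ : Measure Ω) (ω : Ω) (r : ρ) : ℝ :=
  X ω (.inl r) - ∑ s, regression X μ r s * X ω (.inr s)

omit [IsProbabilityMeasure μ] [Fintype ρ] [DecidableEq ρ] in
theorem inl_eq_residual_add (X : Ω → ρ ⊕ σ → ℝ) (ω : Ω) (r : ρ) :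
    X ω (.inl r) = residual X μ ω r + ∑ s, regression X μ r s * X ω (.inr s) := by
  simp [residual]

/-- The regression matrix `Γ` solves the normal equations `Γ C₂₂ = C₁₂`. -/
theorem covariance_residual_inr {X : Ω → ρ ⊕ σ → ℝ} (hX : IsZMNG X μ) (r : ρ) (s : σ) :
    cov[fun ω => residual X μ ω r, fun ω => X ω (.inr s); μ] = 0 := by
  have hs (s) : MemLp (fun ω => regression X μ r s * X ω (.inr s)) 2 μ :=
    (hX.memLp_two _).const_mul _
  unfold residual
  rw [covariance_fun_sub_left (hX.memLp_two _) (memLp_finsetSum _ fun s _ => hs s)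
    (hX.memLp_two _), covariance_fun_sum_left hs (hX.memLp_two _)]
  simp only [covariance_const_mul_left]
  have h : (regression X μ * (covMat X μ).toBlocks₂₂) r s = (covMat X μ).toBlocks₁₂ r s := by
    have hu : IsUnit (covMat X μ).toBlocks₂₂ := (hX.posDef.submatrix Sum.inr_injective).isUnit
    rw [regression, Matrix.mul_assoc, nonsing_inv_mul _ ((isUnit_iff_isUnit_det _).1 hu),
      Matrix.mul_one]
  exact sub_eq_zero.2 h.symm

omit [IsProbabilityMeasure μ] in
theorem hasGaussianLaw_inr_residual {X : Ω → ρ ⊕ σ → ℝ} (hX : IsZMNG X μ) :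
    HasGaussianLaw (fun ω => (fun s => X ω (.inr s), residual X μ ω)) μ := by
  let p (k : ρ ⊕ σ) : (ρ ⊕ σ → ℝ) →L[ℝ] ℝ := ContinuousLinearMap.proj k
  convert! hX.gaussian.map_fun ((ContinuousLinearMap.pi fun s => p (.inr s)).prod
    (ContinuousLinearMap.pi fun r => p (.inl r) - ∑ s, regression X μ r s • p (.inr s)))
    using 2 with ω
  ext r
  · simp [p]
  · simp [p, residual]

theorem isZMNG_residual {X : Ω → ρ ⊕ σ → ℝ} (hX : IsZMNG X μ) : IsZMNG (residual X μ) μ where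
  measurable := by
    have (k : ρ ⊕ σ) : Measurable fun ω => X ω k := (measurable_pi_apply k).comp hX.measurable
    exact measurable_pi_lambda _ fun r => by unfold residual; fun_prop
  gaussian := (hasGaussianLaw_inr_residual hX).snd
  zero_mean r := by
    have hi (k) : Integrable (fun ω => X ω k) μ := (hX.memLp_two k).integrable one_le_two
    unfold residual
    rw [integral_sub (hi _) (integrable_finsetSum _ fun s _ => (hi _).const_mul _),
      integral_finsetSum _ fun s _ => (hi _).const_mul _]
    simp [integral_const_mul, hX.zero_mean]
  nonsingular := by
    have hW (r) : MemLp (fun ω => residual X μ ω r) 2 μ :=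
      ((hasGaussianLaw_inr_residual hX).snd.eval r).memLp_two
    have h := covMat_mul_toBlocks₁₁ hX hW (covariance_residual_inr hX)
      fun r => .of_forall fun ω => inl_eq_residual_add X ω r
    intro h0
    simpa [h0] using congrArg Matrix.det h

theorem covMat_residual_mul {X : Ω → ρ ⊕ σ → ℝ} (hX : IsZMNG X μ) :
    covMat (residual X μ) μ * (covMat X μ)⁻¹.toBlocks₁₁ = 1 :=
  covMat_mul_toBlocks₁₁ hX (isZMNG_residual hX).memLp_two (covariance_residual_inr hX)
    fun r => .of_forall fun ω => inl_eq_residual_add X ω r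

/-- Two blocks of a nonsingular Gaussian vector are conditionally independent given all the other
coordinates if and only if the corresponding block of the precision matrix vanishes. -/
theorem condIndepGiven_iff_precision {α β : Type*} [Fintype α] [DecidableEq α] [Fintype β]
    [DecidableEq β] {X : Ω → (α ⊕ β) ⊕ σ → ℝ} (hX : IsZMNG X μ) :
    CondIndepGiven (MeasurableSpace.comap (fun ω s => X ω (.inr s)) inferInstance)
      (MeasurableSpace.comap (fun ω a => X ω (.inl (.inl a))) inferInstance)
      (MeasurableSpace.comap (fun ω b => X ω (.inl (.inr b))) inferInstance) μ ↔
    ∀ a b, (covMat X μ)⁻¹ (.inl (.inl a)) (.inl (.inr b)) = 0 := by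
  have hW := isZMNG_residual hX
  have hmW (r) : Measurable fun ω => residual X μ ω r := (measurable_pi_apply r).comp hW.measurable
  have hmX (k) : Measurable fun ω => X ω k := (measurable_pi_apply k).comp hX.measurable
  let U : Ω → α → ℝ := fun ω a => residual X μ ω (.inl a)
  let V : Ω → β → ℝ := fun ω b => residual X μ ω (.inr b)
  let Z : Ω → σ → ℝ := fun ω s => X ω (.inr s)
  -- Uncorrelated and jointly Gaussian, hence independent.
  have hind : IndepFun Z (fun ω => (U ω, V ω)) μ := by
    have h : IndepFun Z (residual X μ) μ :=
      (hasGaussianLaw_inr_residual hX).indepFun_of_covariance_eval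
        (X := fun s ω => X ω (.inr s)) (Y := fun r ω => residual X μ ω r) fun s r => by
          rw [covariance_comm]; exact covariance_residual_inr hX r s
    have hm : Measurable fun w : α ⊕ β → ℝ => (fun a => w (.inl a), fun b => w (.inr b)) := by
      fun_prop
    exact h.comp measurable_id hm
  have key := condIndepGiven_add_iff_indepFun (μ := μ) (U := U) (V := V) (Z := Z)
    (g := fun z a => ∑ s, regression X μ (.inl a) s * z s)
    (h := fun z b => ∑ s, regression X μ (.inr b) s * z s)
    (measurable_pi_lambda _ fun _ => hmW _) (measurable_pi_lambda _ fun _ => hmW _)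
    (measurable_pi_lambda _ fun _ => hmX _) (by fun_prop) (by fun_prop) hind
  have eU : (fun ω => U ω + fun a => ∑ s, regression X μ (.inl a) s * Z ω s) =
      fun ω a => X ω (.inl (.inl a)) := by
    ext ω a; exact (inl_eq_residual_add X ω _).symm
  have eV : (fun ω => V ω + fun b => ∑ s, regression X μ (.inr b) s * Z ω s) =
      fun ω b => X ω (.inl (.inr b)) := by
    ext ω a; exact (inl_eq_residual_add X ω _).symm
  rw [eU, eV] at key
  refine key.trans ?_
  -- The covariance of the residual is inverse to a principal block of the precision matrix, so
  -- their off-diagonal blocks vanish together.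
  have hblock := toBlocks₁₂_eq_zero_iff_of_mul_eq_one hW.posDef
    (Q := (covMat X μ)⁻¹.toBlocks₁₁) (hX.posDef.inv.submatrix Sum.inl_injective)
    (covMat_residual_mul hX)
  have hD : IndepFun U V μ ↔ (covMat (residual X μ) μ).toBlocks₁₂ = 0 := by
    constructor
    · intro h
      ext a b
      exact (h.comp (measurable_pi_apply a) (measurable_pi_apply b)).covariance_eq_zero
        (hW.memLp_two (.inl a)) (hW.memLp_two (.inr b))
    · intro h
      refine HasGaussianLaw.indepFun_of_covariance_eval (X := fun a ω => U ω a)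
        (Y := fun b ω => V ω b) ?_ fun a b => congrFun (congrFun h a) b
      let p (k : α ⊕ β) : (α ⊕ β → ℝ) →L[ℝ] ℝ := ContinuousLinearMap.proj k
      exact hW.gaussian.map_fun ((ContinuousLinearMap.pi fun a => p (.inl a)).prod
        (ContinuousLinearMap.pi fun b => p (.inr b)))
  rw [hD, hblock]
  exact ⟨fun h a b => congrFun (congrFun h a) b, fun h => by ext a b; exact h a b⟩

end Gaussian

/-! ### Markov and reciprocal sequences as zero patterns of the precision matrix. -/

section Sequences

variable {Ω ι : Type*} [MeasurableSpace Ω] {μ : Measure Ω} {d : ℕ}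

omit [MeasurableSpace Ω] in
theorem comap_coordinates_eq_sigmaOf (x : ι → Ω → Fin d → ℝ) (S : Set ι) :
    MeasurableSpace.comap (fun ω (p : {p : ι × Fin d // p.1 ∈ S}) => x p.1.1 ω p.1.2)
      inferInstance = sigmaOf x S := by
  simp only [MeasurableSpace.pi, MeasurableSpace.comap_iSup, MeasurableSpace.comap_comp,
    sigmaOf, Function.comp_def]
  apply le_antisymm
  · exact iSup_le fun p => le_iSup_of_le p.1.1 <| le_iSup_of_le p.2 <| le_iSup_of_le p.1.2 le_rfl
  · exact iSup_le fun i => iSup_le fun hi => iSup_le fun a => le_iSup_of_le ⟨(i, a), hi⟩ le_rfl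

variable [IsProbabilityMeasure μ] [Fintype ι] [DecidableEq ι]

/-- For a ZMNG sequence whose times are partitioned into `A`, `B` and `S`, the states in `A` and
in `B` are conditionally independent given those in `S` if and only if the `A × B` block of the
precision matrix vanishes. -/
theorem condIndepGiven_sigmaOf_iff {x : ι → Ω → Fin d → ℝ} (hx : IsZMNGSeq x μ) {A B S : Set ι}
    (hAB : Disjoint A B) (hABS : (A ∪ B)ᶜ = S) :
    CondIndepGiven (sigmaOf x S) (sigmaOf x A) (sigmaOf x B) μ ↔
      ∀ i ∈ A, ∀ j ∈ B, ∀ a b,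
        (covMat (fun ω (p : ι × Fin d) => x p.1 ω p.2) μ)⁻¹ (i, a) (j, b) = 0 := by
  classical
  subst hABS
  let f : ({p : ι × Fin d // p.1 ∈ A} ⊕ {p : ι × Fin d // p.1 ∈ B}) ⊕
      {p : ι × Fin d // p.1 ∈ (A ∪ B)ᶜ} → ι × Fin d :=
    Sum.elim (Sum.elim Subtype.val Subtype.val) Subtype.val
  have hf : f.Bijective := by
    constructor
    · refine Function.Injective.sumElim (Function.Injective.sumElim Subtype.val_injective
        Subtype.val_injective ?_) Subtype.val_injective ?_
      · intro p q h
        exact Set.disjoint_left.1 hAB p.2 (h ▸ q.2)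
      · rintro (p | p) q h
        · exact q.2 (h ▸ Or.inl p.2)
        · exact q.2 (h ▸ Or.inr p.2)
    · intro p
      by_cases hA : p.1 ∈ A
      · exact ⟨.inl (.inl ⟨p, hA⟩), rfl⟩
      by_cases hB : p.1 ∈ B
      · exact ⟨.inl (.inr ⟨p, hB⟩), rfl⟩
      exact ⟨.inr ⟨p, fun h => h.elim hA hB⟩, rfl⟩
  have key := condIndepGiven_iff_precision (hx.comp_injective hf.injective)
  -- Since `f` is a bijection, the reordered vector has the same precision matrix up to reindexing.
  have hinv : (covMat (fun ω k => x (f k).1 ω (f k).2) μ)⁻¹ =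
      (covMat (fun ω (p : ι × Fin d) => x p.1 ω p.2) μ)⁻¹.submatrix f f :=
    inv_submatrix_equiv (covMat (fun ω (p : ι × Fin d) => x p.1 ω p.2) μ)
      (Equiv.ofBijective f hf) (Equiv.ofBijective f hf)
  rw [hinv] at key
  rw [← comap_coordinates_eq_sigmaOf, ← comap_coordinates_eq_sigmaOf,
    ← comap_coordinates_eq_sigmaOf]
  exact key.trans ⟨fun h i hi j hj a b => h ⟨(i, a), hi⟩ ⟨(j, b), hj⟩,
    fun h p q => h _ p.2 _ q.2 _ _⟩

variable [LinearOrder ι]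

theorem isMarkov_iff_precision {x : ι → Ω → Fin d → ℝ} (hx : IsZMNGSeq x μ) :
    IsMarkov x μ ↔ ∀ i k j, i < k → k < j → ∀ a b,
      (covMat (fun ω (p : ι × Fin d) => x p.1 ω p.2) μ)⁻¹ (i, a) (j, b) = 0 := by
  have h (k : ι) := condIndepGiven_sigmaOf_iff hx (A := Set.Iio k) (B := Set.Ioi k) (S := {k})
    (Set.disjoint_left.2 fun _ h h' => lt_asymm h h')
    (by ext i; simp [le_antisymm_iff, and_comm])
  exact ⟨fun hm i k j hi hj => (h k).1 (hm k) i hi j hj,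
    fun hp k => (h k).2 fun i hi j hj => hp i k j hi hj⟩

theorem isReciprocal_iff_precision {x : ι → Ω → Fin d → ℝ} (hx : IsZMNGSeq x μ) :
    IsReciprocal x μ ↔ ∀ j l, j < l → ∀ i ∈ Set.Ioo j l, ∀ m ∉ Set.Icc j l, ∀ a b,
      (covMat (fun ω (p : ι × Fin d) => x p.1 ω p.2) μ)⁻¹ (i, a) (m, b) = 0 := by
  refine forall₃_congr fun j l hjl => condIndepGiven_sigmaOf_iff hx
    (Set.disjoint_left.2 fun i h h' => h' (Set.Ioo_subset_Icc_self h)) ?_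
  rw [Set.compl_union, compl_compl, Set.inter_comm, ← Set.sdiff_eq, Set.Icc_sdiff_Ioo_same hjl.le]

end Sequences

/-! ### Markov representations and deletion of one time. -/

section Representation

variable {Ω : Type*} [MeasurableSpace Ω] {μ : Measure Ω} [IsProbabilityMeasure μ] {N d : ℕ}

/-- Separation of the coordinates of the state at time `c` from the others. -/
def splitAt (c : Fin (N + 1)) : ({k // k ≠ c} × Fin d) ⊕ Fin d → Fin (N + 1) × Fin d :=
  Sum.elim (fun p => (p.1.1, p.2)) fun a => (c, a)

theorem splitAt_bijective (c : Fin (N + 1)) : (splitAt (d := d) c).Bijective := by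
  constructor
  · refine Function.Injective.sumElim ?_ (fun a b h => (Prod.ext_iff.1 h).2)
      fun p a h => p.1.2 (Prod.ext_iff.1 h).1
    exact fun p q h => Prod.ext (Subtype.ext (Prod.ext_iff.1 h).1) (Prod.ext_iff.1 h).2
  · rintro ⟨k, a⟩
    by_cases h : k = c
    · exact ⟨.inr a, by rw [h]; rfl⟩
    · exact ⟨.inl (⟨k, h⟩, a), rfl⟩

theorem isZMNG_splitAt {x : Fin (N + 1) → Ω → Fin d → ℝ} (hx : IsZMNGSeq x μ)
    (c : Fin (N + 1)) : IsZMNG (fun ω k => x (splitAt c k).1 ω (splitAt c k).2) μ :=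
  hx.comp_injective (splitAt_bijective c).injective

omit [IsProbabilityMeasure μ] in
theorem inv_covMat_splitAt (x : Fin (N + 1) → Ω → Fin d → ℝ) (c : Fin (N + 1)) :
    (covMat (fun ω k => x (splitAt c k).1 ω (splitAt c k).2) μ)⁻¹ =
      (covMat (fun ω (p : Fin (N + 1) × Fin d) => x p.1 ω p.2) μ)⁻¹.submatrix
        (splitAt c) (splitAt c) :=
  inv_submatrix_equiv (covMat (fun ω (p : Fin (N + 1) × Fin d) => x p.1 ω p.2) μ)
    (Equiv.ofBijective _ (splitAt_bijective c)) (Equiv.ofBijective _ (splitAt_bijective c))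

/-- A ZMNG sequence `x` admits a Markov representation with respect to the time `c` if and only if
its precision matrix with the time `c` removed is block tridiagonal. -/
theorem exists_isMarkovRep_iff {x : Fin (N + 1) → Ω → Fin d → ℝ} (hx : IsZMNGSeq x μ)
    (c : Fin (N + 1)) :
    (∃ y Γ, IsMarkovRep x μ c y Γ) ↔
      ∀ i k j, i ≠ c → k ≠ c → j ≠ c → i < k → k < j → ∀ a b,
        (covMat (fun ω (p : Fin (N + 1) × Fin d) => x p.1 ω p.2) μ)⁻¹ (i, a) (j, b) = 0 := by
  have hX := isZMNG_splitAt hx c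
  constructor
  · rintro ⟨y, Γ, h⟩ i k j hi hk hj hik hkj a b
    -- This pins down the precision of `y` for every choice of `y` and `Γ`, so its Markov property
    -- constrains the precision of `x`.
    have hmul := covMat_mul_toBlocks₁₁ hX h.seq_zmng.memLp_two (Γ := .of fun p e => Γ p.1 p.2 e)
      (fun p e => h.uncorrelated p.1 p.2 e) fun p => by
        filter_upwards [h.eq_sum p.1] with ω hω
        exact congrFun hω p.2
    have hm := (isMarkov_iff_precision h.seq_zmng).1 h.seq_markov ⟨i, hi⟩ ⟨k, hk⟩ ⟨j, hj⟩ hik hkj a b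
    rw [inv_eq_right_inv hmul, inv_covMat_splitAt] at hm
    exact hm
  · intro h
    let X : Ω → ({k // k ≠ c} × Fin d) ⊕ Fin d → ℝ :=
      fun ω k => x (splitAt c k).1 ω (splitAt c k).2
    let y : {k // k ≠ c} → Ω → Fin d → ℝ := fun k ω a => residual X μ ω (k, a)
    have hy : IsZMNGSeq y μ := isZMNG_residual hX
    refine ⟨y, fun k => .of fun a e => regression X μ (k, a) e, hy, ?_,
      hX.comp_injective Sum.inr_injective, fun k a b => covariance_residual_inr hX (k, a) b,
      fun k => .of_forall fun ω => funext fun a => inl_eq_residual_add X ω (k, a)⟩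
    rw [isMarkov_iff_precision hy]
    intro i k j hik hkj a b
    have hinv : (covMat (fun ω (p : {k // k ≠ c} × Fin d) => y p.1 ω p.2) μ)⁻¹ = _ :=
      inv_eq_right_inv (covMat_residual_mul hX)
    rw [hinv, inv_covMat_splitAt]
    exact h i k j i.2 k.2 j.2 hik hkj a b

end Representation
end GaussSeq

/-! ### Comparison of the zero patterns. -/

theorem mainTheorem3 {Ω : Type*} [MeasurableSpace Ω] (μ : Measure Ω) [IsProbabilityMeasure μ]
    (N d : ℕ) (x : Fin (N + 1) → Ω → Fin d → ℝ) (hx : GaussSeq.IsZMNGSeq x μ) :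
    GaussSeq.IsReciprocal x μ ↔
      (∃ (yL : {k : Fin (N + 1) // k ≠ Fin.last N} → Ω → Fin d → ℝ)
          (ΓL : {k : Fin (N + 1) // k ≠ Fin.last N} → Matrix (Fin d) (Fin d) ℝ),
        GaussSeq.IsMarkovRep x μ (Fin.last N) yL ΓL) ∧
      (∃ (yF : {k : Fin (N + 1) // k ≠ 0} → Ω → Fin d → ℝ)
          (ΓF : {k : Fin (N + 1) // k ≠ 0} → Matrix (Fin d) (Fin d) ℝ),
        GaussSeq.IsMarkovRep x μ 0 yF ΓF) := by
  rw [GaussSeq.isReciprocal_iff_precision hx, GaussSeq.exists_isMarkovRep_iff hx,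
    GaussSeq.exists_isMarkovRep_iff hx]
  have hsymm (i j : Fin (N + 1)) (a b : Fin d)
      (h : (GaussSeq.covMat (fun ω (p : Fin (N + 1) × Fin d) => x p.1 ω p.2) μ)⁻¹ (i, a) (j, b) = 0) :
      (GaussSeq.covMat (fun ω (p : Fin (N + 1) × Fin d) => x p.1 ω p.2) μ)⁻¹ (j, b) (i, a) = 0 := by
    rw [← h, ← hx.posDef.inv.isHermitian.apply]
    rfl
  constructor
  · intro h
    refine ⟨fun i k j hi hk hj hik hkj a b => ?_, fun i k j hi hk hj hik hkj a b => ?_⟩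
    · obtain ⟨j', rfl⟩ : ∃ j', j = Fin.castSucc j' := ⟨j.castPred hj, by simp⟩
      exact hsymm _ _ _ _ <| h k j'.succ (hkj.trans j'.castSucc_lt_succ) _
        ⟨hkj, j'.castSucc_lt_succ⟩ i (fun hm => hm.1.not_gt hik) b a
    · obtain ⟨i', rfl⟩ : ∃ i', i = Fin.succ i' := ⟨i.pred hi, by simp⟩
      exact h i'.castSucc k (i'.castSucc_lt_succ.trans hik) _
        ⟨i'.castSucc_lt_succ, hik⟩ j (fun hm => hm.2.not_gt hkj) a b
  · rintro ⟨hL, hF⟩ j l hjl i ⟨hji, hil⟩ m hm a b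
    -- If `m < j < i < l`, none of `m`, `j`, `i` is the last time, so deleting `N` applies with `j`
    -- in between. If `j < i < l < m`, none of `i`, `l`, `m` is `0`, so deleting `0` applies with
    -- `l` in between.
    rcases lt_or_ge m j with hmj | hjm
    · exact hsymm _ _ _ _ <| hL m j i (hmj.trans (hjl.trans_le (Fin.le_last l))).ne
        (hjl.trans_le (Fin.le_last l)).ne (hil.trans_le (Fin.le_last l)).ne hmj hji b a
    · have hlm : l < m := lt_of_not_ge fun h => hm ⟨hjm, h⟩
      exact hF i l m ((Fin.zero_le j).trans_lt hji).ne' ((Fin.zero_le j).trans_lt hjl).ne'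
        ((Fin.zero_le l).trans_lt hlm).ne' hil hlm a b
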